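/- **Theorem (Companion-Jordan form).** Let $H$ be a field with $\mathbb{Q}\subset H\subset\mathbb{C}$ and let $A\in H^{n\times n}$. For a monic polynomial $g(\lambda)=\lambda^k+a_{k-1}\lambda^{k-1}+\cdots+a_0\in H[\lambda]$ let $C_g$ be its $k\times k$ companion matrix, with ones on the first superdiagonal, last row $(-a_0,-a_1,\ldots,-a_{k-1})$, and zeros elsewhere. For $d\ge 1$ let $N_d$ be the $d\times d$ matrix with ones on the first superdiagonal and zeros elsewhere. The matrix $A$ has elementary divisors over $H$: there are monic polynomials $g_1,\ldots,g_r\in H[\lambda]$, irreducible over $H$ and not necessarily distinct, and integers $d_1,\ldots,d_r\ge 1$, such that the $H[\lambda]$-module $H^n$, on which $\lambda$ acts as $A$, is isomorphic to $\bigoplus_{j=1}^r H[\lambda]/(g_j^{d_j})$. For every such system $g_1^{d_1},\ldots,g_r^{d_r}$ of elementary divisors, with $k_j=\deg g_j$, one has $$p_A(\lambda)=\det(\lambda I_n-A)=\prod_{j=1}^r g_j(\lambda)^{d_j},\qquad \sum_{j=1}^r k_jd_j=n,$$ and there is an invertible matrix $T\in H^{n\times n}$ such that $$A=T^{-1}(C_1\oplus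 C_2\oplus\cdots\oplus C_r)T,\qquad C_j=I_{d_j}\otimes C_{g_j}+N_{d_j}\otimes I_{k_j}=\begin{bmatrix} C_{g_j} & I_{k_j} & & 0\\ & C_{g_j} & \ddots & \\ & & \ddots & I_{k_j}\\ 0 & & & C_{g_j} \end{bmatrix}\in H^{d_jk_j\times d_jk_j}.$$ This form is unique up to permutation of the blocks: if $A$ is similar over $H$ both to $C_1\oplus\cdots\oplus C_r$ and to $C_1'\oplus\cdots\oplus C_{r'}'$, where $C_j=I_{d_j}\otimes C_{g_j}+N_{d_j}\otimes I_{k_j}$ and $C_j'=I_{d_j'}\otimes C_{g_j'}+N_{d_j'}\otimes I_{k_j'}$ with all $g_j,g_j'\in H[\lambda]$ monic and irreducible over $H$, of degrees $k_j,k_j'$, and all $d_j,d_j'\ge 1$, then $r=r'$ and there is a permutation $\sigma$ of $\{1,\ldots,r\}$ with $g_{\sigma(j)}'=g_j$ and $d_{\sigma(j)}'=d_j$ (hence $C_{\sigma(j)}'=C_j$) for all $j$. -/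

import Mathlib

/-!
Let `X` act on the column space of a square matrix as that matrix: similarity of matrices over `K`
becomes isomorphism of `K[X]`-modules, and a direct sum of matrices becomes a product of modules.

The block of `(g, d)` is `S + N` with commuting `S` and `N`, where `g(S) = 0` and `N` is nilpotent
of order `d`. If `g` is separable, then `g'(S)` is a unit, so by Taylor's formula `g(S + N)` is `N`
times a unit, and `g ^ k` annihilates the block exactly when `d ≤ k`. Hence, for irreducible `g`,
the minimal polynomial `g ^ d` of the block has the largest possible degree, which makes its module
cyclic: it is `K[X] / (g ^ d)`. Thus `A` is similar to a direct sum of blocks exactly when its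
module is the corresponding product of primary cyclic modules.

The factors of such a product `M` over a principal ideal domain `R` are read off from lengths: for
a prime `p`, the length of `R / (p ^ m) ⊗ M` is the sum of `min k m` over the factors `R / (q ^ k)`
with `q` associated to `p`, and its second differences in `m` are, up to sign, the multiplicities.
-/

open Polynomial
open scoped Kronecker DirectSum

namespace CompanionJordan

variable {K : Type*} [Field K]

/-- The companion matrix `C_g` of `g = λ^k + a_{k-1} λ^{k-1} + ⋯ + a_0`: ones on the superdiagonal
and last row `-a_0, …, -a_{k-1}`. -/
def companion (g : K[X]) : Matrix (Fin g.natDegree) (Fin g.natDegree) K :=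
  Matrix.of fun i j =>
    if (i : ℕ) + 1 = g.natDegree then -g.coeff j
    else if (i : ℕ) + 1 = j then 1 else 0

/-- The `d × d` matrix with ones on the superdiagonal and zeros elsewhere. -/
def shift (K : Type*) [Field K] (d : ℕ) : Matrix (Fin d) (Fin d) K :=
  Matrix.of fun i j => if (i : ℕ) + 1 = j then 1 else 0

/-- The block `I_d ⊗ C_g + N ⊗ I_k`, `k = deg g`: the `dk × dk` block upper bidiagonal matrix with
`C_g` on the diagonal and `I_k` on the superdiagonal. -/
def block (g : K[X]) (d : ℕ) : Matrix (Fin (d * g.natDegree)) (Fin (d * g.natDegree)) K :=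
  Matrix.reindex finProdFinEquiv finProdFinEquiv
    ((1 : Matrix (Fin d) (Fin d) K) ⊗ₖ companion g +
      shift K d ⊗ₖ (1 : Matrix (Fin g.natDegree) (Fin g.natDegree) K))

/-- The direct sum `C_1 ⊕ ⋯ ⊕ C_r` of the blocks of the pairs `(g_j, d_j)`, in this order. -/
def blockSum {r : ℕ} (g : Fin r → K[X]) (d : Fin r → ℕ) :
    Matrix (Fin (∑ j, d j * (g j).natDegree)) (Fin (∑ j, d j * (g j).natDegree)) K :=
  Matrix.reindex finSigmaFinEquiv finSigmaFinEquiv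
    (Matrix.blockDiagonal' fun j => block (g j) (d j))

/-- `A = T⁻¹ (C_1 ⊕ ⋯ ⊕ C_r) T` for an invertible `T` with entries in `K`; in particular the sizes
of the blocks add up to `n`. -/
def IsSimilarToBlockSum {n r : ℕ} (A : Matrix (Fin n) (Fin n) K)
    (g : Fin r → K[X]) (d : Fin r → ℕ) : Prop :=
  ∃ h : ∑ j, d j * (g j).natDegree = n, ∃ T : GL (Fin n) K,
    A = ((T⁻¹ : GL (Fin n) K) : Matrix (Fin n) (Fin n) K) *
      Matrix.reindex (finCongr h) (finCongr h) (blockSum g d) * (T : Matrix (Fin n) (Fin n) K)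

/-- The `g_j` are monic irreducible polynomials and the `d_j` are positive. -/
def IsPrimePowerFamily {r : ℕ} (g : Fin r → K[X]) (d : Fin r → ℕ) : Prop :=
  ∀ j, (g j).Monic ∧ Irreducible (g j) ∧ 0 < d j

/-- The elementary divisors of `A` (listed with repetition) are `g_1^{d_1}, …, g_r^{d_r}`: the
`K[X]`-module `K^n`, on which `X` acts as `A`, is the direct sum of primary cyclic modules
`K[X] / (g_j^{d_j})`. -/
def IsElementaryDivisors {n r : ℕ} (A : Matrix (Fin n) (Fin n) K)
    (g : Fin r → K[X]) (d : Fin r → ℕ) : Prop :=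
  IsPrimePowerFamily g d ∧
    Nonempty (Module.AEval' (Matrix.toLin' A) ≃ₗ[K[X]]
      ⨁ j : Fin r, K[X] ⧸ Submodule.span K[X] {g j ^ d j})

end CompanionJordan

open scoped TensorProduct Matrix

namespace CompanionJordan

section Multiplicities

variable {ι : Type*} (s : Finset ι) (k : ι → ℕ)

/-- Minus the second difference of `m ↦ ∑ i, min (k i) m`, written without subtraction. -/
lemma card_filter_add_sum_min_add_sum_min (m : ℕ) :
    {i ∈ s | k i = m + 1}.card + ∑ i ∈ s, min (k i) m + ∑ i ∈ s, min (k i) (m + 2) =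
      2 * ∑ i ∈ s, min (k i) (m + 1) := by
  rw [Finset.card_filter, ← Finset.sum_add_distrib, ← Finset.sum_add_distrib, Finset.mul_sum]
  exact Finset.sum_congr rfl fun i _ => by split_ifs <;> omega

variable {s k} {ι' : Type*} {s' : Finset ι'} {k' : ι' → ℕ}

lemma card_filter_eq_of_sum_min_eq
    (h : ∀ m, ∑ i ∈ s, min (k i) m = ∑ i ∈ s', min (k' i) m) {m : ℕ} (hm : m ≠ 0) :
    {i ∈ s | k i = m}.card = {i ∈ s' | k' i = m}.card := by
  obtain ⟨m, rfl⟩ := Nat.exists_eq_add_one_of_ne_zero hm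
  have hs := card_filter_add_sum_min_add_sum_min s k m
  rw [h, h, h, ← card_filter_add_sum_min_add_sum_min s' k' m] at hs
  simpa using hs

end Multiplicities

section CommRing

variable {R : Type*} [CommRing R]

/-- The tensor product of two cyclic modules is cyclic. -/
noncomputable def quotTensorQuotEquivQuotSup (I J : Ideal R) :
    (R ⧸ I) ⊗[R] (R ⧸ J) ≃ₗ[R] R ⧸ J ⊔ I :=
  TensorProduct.quotTensorEquivQuotSMul (R ⧸ J) I ≪≫ₗ
    Submodule.quotEquivOfEq _ _ (by
      rw [← J.range_mkQ, ← Submodule.map_top, ← Submodule.map_smul'', smul_eq_mul, Ideal.mul_top])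
      ≪≫ₗ Submodule.quotientQuotientEquivQuotientSup J I

lemma length_quot_tensor_pi_quot {ι : Type*} [Fintype ι] (I : Ideal R) (J : ι → Ideal R) :
    Module.length R ((R ⧸ I) ⊗[R] (Π i, R ⧸ J i)) = ∑ i, Module.length R (R ⧸ J i ⊔ I) := by
  classical
  rw [(TensorProduct.piRight R R (R ⧸ I) fun i => R ⧸ J i).length_eq, Module.length_pi_of_fintype]
  exact Finset.sum_congr rfl fun i _ => (quotTensorQuotEquivQuotSup I (J i)).length_eq

lemma bijective_pi_proj_subtype {ι : Type*} {M : ι → Type*} [∀ i, AddCommGroup (M i)]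
    [∀ i, Module R (M i)] {P : ι → Prop} (hM : ∀ i, ¬ P i → Subsingleton (M i)) :
    Function.Bijective
      (LinearMap.pi fun i : {i // P i} => LinearMap.proj (R := R) (φ := M) i.1) := by
  classical
  refine ⟨fun x y hxy => funext fun i => ?_, fun y => ?_⟩
  · by_cases hi : P i
    · exact congrFun hxy ⟨i, hi⟩
    · exact (hM i hi).elim _ _
  · exact ⟨fun i => if hi : P i then y ⟨i, hi⟩ else 0, funext fun i => dif_pos i.2⟩

end CommRing

section PrincipalIdealDomain

variable {R : Type*} [CommRing R] [IsDomain R] [IsPrincipalIdealRing R]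

lemma length_quotient_span_pow {p : R} (hp : Irreducible p) (n : ℕ) :
    Module.length R (R ⧸ Ideal.span {p ^ n}) = n := by
  have h := Ring.ord_pow (mem_nonZeroDivisors_of_ne_zero hp.ne_zero) n
  rwa [Ring.ord_of_irreducible hp, nsmul_one] at h

open Classical in
lemma length_quotient_span_pow_sup_span_pow {p q : R} (hp : Irreducible p) (hq : Irreducible q)
    (k m : ℕ) :
    Module.length R (R ⧸ Ideal.span {p ^ k} ⊔ Ideal.span {q ^ m}) =
      if Associated p q then (min k m : ℕ) else 0 := by
  split_ifs with hpq
  · have span_le {a b : ℕ} (h : a ≤ b) : Ideal.span {p ^ b} ≤ Ideal.span {p ^ a} :=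
      Ideal.span_singleton_le_span_singleton.2 (pow_dvd_pow p h)
    rw [← Ideal.span_singleton_eq_span_singleton.2 (hpq.pow_pow (n := m))]
    obtain h | h := le_total k m
    · rw [sup_of_le_left (span_le h), length_quotient_span_pow hp, min_eq_left h]
    · rw [sup_of_le_right (span_le h), length_quotient_span_pow hp, min_eq_right h]
  · have hcop : IsCoprime (p ^ k) (q ^ m) :=
      (hp.coprime_iff_not_dvd.2 fun h => hpq (hp.associated_of_dvd hq h)).pow
    rw [← Ideal.isCoprime_span_singleton_iff, Ideal.isCoprime_iff_sup_eq] at hcop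
    rw [hcop]
    exact Module.length_eq_zero

variable {ι ι' : Type*} {p : ι → R} {p' : ι' → R} {k : ι → ℕ} {k' : ι' → ℕ}

open Classical in
lemma sum_min_eq_of_pi_quotient_equiv [Fintype ι] [Fintype ι']
    (hp : ∀ i, Irreducible (p i)) (hp' : ∀ i, Irreducible (p' i))
    (e : (Π i, R ⧸ Ideal.span {p i ^ k i}) ≃ₗ[R] Π i, R ⧸ Ideal.span {p' i ^ k' i})
    {q : R} (hq : Irreducible q) (m : ℕ) :
    ∑ i with Associated (p i) q, min (k i) m = ∑ i with Associated (p' i) q, min (k' i) m := by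
  have h := (e.lTensor (R ⧸ Ideal.span {q ^ m})).length_eq
  simp only [length_quot_tensor_pi_quot, length_quotient_span_pow_sup_span_pow (hp _) hq,
    length_quotient_span_pow_sup_span_pow (hp' _) hq] at h
  rw [Finset.sum_filter, Finset.sum_filter]
  exact_mod_cast h

theorem exists_equiv_of_pi_quotient_equiv [Finite ι] [Finite ι']
    (hp : ∀ i, Irreducible (p i)) (hp' : ∀ i, Irreducible (p' i))
    (hk : ∀ i, k i ≠ 0) (hk' : ∀ i, k' i ≠ 0)
    (e : (Π i, R ⧸ Ideal.span {p i ^ k i}) ≃ₗ[R] Π i, R ⧸ Ideal.span {p' i ^ k' i}) :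
    ∃ σ : ι ≃ ι', ∀ i, Associated (p' (σ i)) (p i) ∧ k' (σ i) = k i := by
  classical
  have := Fintype.ofFinite ι
  have := Fintype.ofFinite ι'
  let f (i : ι) : Associates R × ℕ := (Associates.mk (p i), k i)
  let f' (i : ι') : Associates R × ℕ := (Associates.mk (p' i), k' i)
  have fiber_equiv (c : Associates R × ℕ) : Nonempty ({i // f i = c} ≃ {i // f' i = c}) := by
    obtain ⟨a, m⟩ := c
    obtain ⟨q, rfl⟩ := Associates.mk_surjective a
    simp only [f, f', Prod.mk.injEq, Associates.mk_eq_mk_iff_associated]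
    by_cases hqm : Irreducible q ∧ m ≠ 0
    · have h := card_filter_eq_of_sum_min_eq (sum_min_eq_of_pi_quotient_equiv hp hp' e hqm.1) hqm.2
      rw [Finset.filter_filter, Finset.filter_filter] at h
      exact ⟨Fintype.equivOfCardEq (by rwa [Fintype.card_subtype, Fintype.card_subtype])⟩
    · have : IsEmpty {i // Associated (p i) q ∧ k i = m} :=
        ⟨fun ⟨i, hi⟩ => hqm ⟨hi.1.irreducible (hp i), hi.2 ▸ hk i⟩⟩
      have : IsEmpty {i // Associated (p' i) q ∧ k' i = m} :=
        ⟨fun ⟨i, hi⟩ => hqm ⟨hi.1.irreducible (hp' i), hi.2 ▸ hk' i⟩⟩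
      exact ⟨Equiv.equivOfIsEmpty _ _⟩
  refine ⟨Equiv.ofFiberEquiv fun c => (fiber_equiv c).some, fun i => ?_⟩
  have h : f' _ = f i := Equiv.ofFiberEquiv_map (fun c => (fiber_equiv c).some) i
  simpa only [f, f', Prod.mk.injEq, Associates.mk_eq_mk_iff_associated] using h

/-- Unlike `Module.equiv_directSum_of_isTorsion`, this leaves no factor with exponent zero. -/
theorem exists_pi_quotient_equiv_of_isTorsion {M : Type*} [AddCommGroup M] [Module R M]
    [Module.Finite R M] (hM : Module.IsTorsion R M) :
    ∃ (r : ℕ) (p : Fin r → R) (k : Fin r → ℕ), (∀ i, Irreducible (p i)) ∧ (∀ i, k i ≠ 0) ∧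
      Nonempty (M ≃ₗ[R] Π i, R ⧸ Ideal.span {p i ^ k i}) := by
  classical
  obtain ⟨ι, _, p, hp, k, ⟨e⟩⟩ := Module.equiv_directSum_of_isTorsion hM
  let E : Fin (Fintype.card {i // k i ≠ 0}) ≃ {i // k i ≠ 0} := (Fintype.equivFin _).symm
  have subsingleton_quot (i : ι) (hi : ¬ k i ≠ 0) : Subsingleton (R ⧸ Ideal.span {p i ^ k i}) := by
    rw [not_not.1 hi, pow_zero, Ideal.span_singleton_one]
    exact Submodule.Quotient.subsingleton_iff.2 rfl
  refine ⟨_, fun i => p (E i), fun i => k (E i), fun i => hp _, fun i => (E i).2, ⟨?_⟩⟩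
  exact e ≪≫ₗ DirectSum.linearEquivFunOnFintype R ι _ ≪≫ₗ
    LinearEquiv.ofBijective _ (bijective_pi_proj_subtype subsingleton_quot) ≪≫ₗ
    (LinearEquiv.piCongrLeft R
      (fun i : {i // k i ≠ 0} => R ⧸ Ideal.span {p i ^ k i}) E).symm

end PrincipalIdealDomain

section MatrixModule

variable {R : Type*} [CommRing R] {ι κ : Type*} [Fintype ι] [DecidableEq ι] [Fintype κ]
  [DecidableEq κ]

/-- The `R[X]`-module of column vectors over `R` on which `X` acts as the matrix `A`. -/
abbrev XModule (A : Matrix ι ι R) : Type _ := Module.AEval' (Matrix.toLin' A)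

lemma finrank_xModule [Nontrivial R] (A : Matrix ι ι R) :
    Module.finrank R (XModule A) = Fintype.card ι :=
  (Module.AEval'.of (Matrix.toLin' A)).finrank_eq.symm.trans (Module.finrank_fintype_fun_eq_card R)

/-- The isomorphism of `R[X]`-modules given by a linear equivalence intertwining `A` and `B`. -/
noncomputable def XModule.congr {A : Matrix ι ι R} {B : Matrix κ κ R}
    (e : (ι → R) ≃ₗ[R] (κ → R)) (he : ∀ v, e (A *ᵥ v) = B *ᵥ e v) :
    XModule A ≃ₗ[R[X]] XModule B :=
  LinearEquiv.ofAEval (Matrix.toLin' A) (e ≪≫ₗ Module.AEval'.of (Matrix.toLin' B)) fun v => by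
    simp [he, Module.AEval'.X_smul_of]

/-- Renaming the indices of a matrix does not change its `R[X]`-module. -/
noncomputable def XModule.reindex (e : ι ≃ κ) (A : Matrix ι ι R) :
    XModule (Matrix.reindex e e A) ≃ₗ[R[X]] XModule A :=
  XModule.congr (LinearEquiv.funCongrLeft R R e) fun v => by
    ext i
    simp [Matrix.submatrix_mulVec_equiv, LinearEquiv.funCongrLeft_apply, LinearMap.funLeft,
      Function.comp_def]

theorem nonempty_xModule_equiv_iff {A B : Matrix ι ι R} :
    Nonempty (XModule A ≃ₗ[R[X]] XModule B) ↔
      ∃ T : GL ι R, A = (↑T⁻¹ : Matrix ι ι R) * B * (T : Matrix ι ι R) := by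
  constructor
  · rintro ⟨e⟩
    let f : (ι → R) ≃ₗ[R] (ι → R) :=
      Module.AEval'.of _ ≪≫ₗ e.restrictScalars R ≪≫ₗ (Module.AEval'.of _).symm
    have hf (v : ι → R) : f (A *ᵥ v) = B *ᵥ f v := by
      refine (Module.AEval'.of (Matrix.toLin' B)).injective ?_
      calc Module.AEval'.of _ (f (A *ᵥ v)) = e (Module.AEval'.of _ (Matrix.toLin' A v)) :=
            LinearEquiv.apply_symm_apply _ _
        _ = (X : R[X]) • e (Module.AEval'.of _ v) := by
            rw [← Module.AEval'.X_smul_of, e.map_smul]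
        _ = (X : R[X]) • Module.AEval'.of _ (f v) :=
            congrArg ((X : R[X]) • ·) (LinearEquiv.apply_symm_apply _ _).symm
        _ = Module.AEval'.of _ (B *ᵥ f v) := Module.AEval'.X_smul_of _ _
    let T : GL ι R := Matrix.GeneralLinearGroup.toLin.symm (.ofLinearEquiv f)
    have hT (v : ι → R) : (T : Matrix ι ι R) *ᵥ v = f v :=
      LinearMap.congr_fun (Matrix.toLin'_toMatrix' f.toLinearMap) v
    have hTA : (T : Matrix ι ι R) * A = B * (T : Matrix ι ι R) :=
      Matrix.mulVec_injective <| funext fun v => by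
        rw [← Matrix.mulVec_mulVec, ← Matrix.mulVec_mulVec, hT, hT, hf]
    refine ⟨T, ?_⟩
    rw [mul_assoc, ← hTA, ← mul_assoc, T.inv_mul, one_mul]
  · rintro ⟨T, hT⟩
    refine ⟨XModule.congr (Matrix.GeneralLinearGroup.toLin T).toLinearEquiv fun v => ?_⟩
    change (T : Matrix ι ι R) *ᵥ (A *ᵥ v) = B *ᵥ ((T : Matrix ι ι R) *ᵥ v)
    rw [hT, Matrix.mulVec_mulVec, Matrix.mulVec_mulVec, ← mul_assoc, ← mul_assoc, T.mul_inv,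
      one_mul]

variable {m : ι → Type*} [∀ i, Fintype (m i)]

lemma blockDiagonal'_mulVec (M : ∀ i, Matrix (m i) (m i) R) (v : (Σ i, m i) → R) (i : ι)
    (a : m i) :
    (Matrix.blockDiagonal' M *ᵥ v) ⟨i, a⟩ = (M i *ᵥ fun b => v ⟨i, b⟩) a := by
  simp only [Matrix.mulVec, dotProduct, Fintype.sum_sigma]
  rw [Fintype.sum_eq_single i]
  · simp only [Matrix.blockDiagonal'_apply_eq]
  · intro j hj
    exact Finset.sum_eq_zero fun b _ => by
      rw [Matrix.blockDiagonal'_apply_ne M a b hj.symm, zero_mul]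

variable [∀ i, DecidableEq (m i)]

/-- The `R[X]`-module of a direct sum of matrices is the product of their `R[X]`-modules. -/
noncomputable def XModule.blockDiagonal' (M : ∀ i, Matrix (m i) (m i) R) :
    XModule (Matrix.blockDiagonal' M) ≃ₗ[R[X]] Π i, XModule (M i) :=
  let e : ((Σ i, m i) → R) ≃ₗ[R] Π i, XModule (M i) :=
    LinearEquiv.piCurry R (fun _ _ => R) ≪≫ₗ
      LinearEquiv.piCongrRight fun i => Module.AEval'.of (Matrix.toLin' (M i))
  LinearEquiv.ofAEval (Matrix.toLin' (Matrix.blockDiagonal' M)) e fun v => by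
    funext i
    change Module.AEval'.of (Matrix.toLin' (M i)) (fun a => (Matrix.blockDiagonal' M *ᵥ v) ⟨i, a⟩) =
      (X : R[X]) • Module.AEval'.of (Matrix.toLin' (M i)) (fun a => v ⟨i, a⟩)
    rw [Module.AEval'.X_smul_of, Matrix.toLin'_apply]
    exact congrArg _ (funext (blockDiagonal'_mulVec M v i))

end MatrixModule

section Charpoly

variable {R : Type*} [CommRing R]

lemma charpoly_eq_prod_charpoly_toSquareBlock {n α : Type*} [Fintype n] [DecidableEq n] [Fintype α]
    [LinearOrder α] {M : Matrix n n R} {b : n → α} (hM : M.BlockTriangular b) :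
    M.charpoly = ∏ i, (M.toSquareBlock b i).charpoly := by
  rw [Matrix.charpoly, hM.charmatrix.det_fintype]
  simp only [Matrix.charpoly, Matrix.charmatrix_toSquareBlock]

lemma charpoly_blockDiagonal' {ι : Type*} [Fintype ι] [LinearOrder ι] {m : ι → Type*}
    [∀ i, Fintype (m i)] [∀ i, DecidableEq (m i)] (M : ∀ i, Matrix (m i) (m i) R) :
    (Matrix.blockDiagonal' M).charpoly = ∏ i, (M i).charpoly := by
  rw [charpoly_eq_prod_charpoly_toSquareBlock (Matrix.blockTriangular_blockDiagonal' M)]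
  refine Finset.prod_congr rfl fun i _ => ?_
  rw [← Matrix.charpoly_reindex (Equiv.sigmaSubtype i)]
  congr 1
  ext a b
  exact Matrix.blockDiagonal'_apply_eq M i a b

end Charpoly

section Cyclic

variable {K V : Type*} [Field K] [AddCommGroup V] [Module K V] [FiniteDimensional K V]

theorem nonempty_aeval_equiv_quotient_minpoly {f : Module.End K V}
    (hf : (minpoly K f).natDegree = Module.finrank K V) :
    Nonempty (Module.AEval' f ≃ₗ[K[X]] K[X] ⧸ Ideal.span {minpoly K f}) := by
  obtain ⟨v, hv⟩ := Module.exists_ker_toSpanSingleton_eq_annihilator K[X] (Module.AEval' f)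
  rw [← span_minpoly_eq_annihilator] at hv
  let φ : (K[X] ⧸ Ideal.span {minpoly K f}) →ₗ[K[X]] Module.AEval' f :=
    Submodule.liftQ _ (LinearMap.toSpanSingleton K[X] _ v) hv.ge
  have hφ : Function.Injective φ :=
    LinearMap.ker_eq_bot.1 (Submodule.ker_liftQ_eq_bot _ _ _ hv.le)
  have finrank_eq : Module.finrank K (K[X] ⧸ Ideal.span {minpoly K f}) =
      Module.finrank K (Module.AEval' f) := by
    rw [finrank_quotient_span_eq_natDegree, hf, (Module.AEval'.of f).finrank_eq]
  have := FiniteDimensional.of_injective (φ.restrictScalars K) hφ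
  exact ⟨(LinearEquiv.ofBijective φ ⟨hφ, (LinearMap.injective_iff_surjective_of_finrank_eq_finrank
    (f := φ.restrictScalars K) finrank_eq).1 hφ⟩).symm⟩

end Cyclic

section Taylor

variable {R A : Type*} [CommRing R] {g : R[X]}

/-- By Taylor's formula `g (s + n) = n (g' s + c n)`, where `g' s` is a unit by separability. -/
lemma associated_aeval_add_of_isNilpotent [CommRing A] [Algebra R A] (hg : g.Separable) {s n : A}
    (hs : aeval s g = 0) (hn : IsNilpotent n) : Associated n (aeval (s + n) g) := by
  have isUnit_derivative : IsUnit (aeval s (derivative g)) := by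
    have h := IsCoprime.map hg (aeval s).toRingHom
    rwa [AlgHom.toRingHom_eq_coe, AlgHom.coe_toRingHom, hs, isCoprime_zero_left] at h
  obtain ⟨c, taylor⟩ := binomExpansion (g.map (algebraMap R A)) s n
  rw [derivative_map, eval_map_algebraMap, eval_map_algebraMap, eval_map_algebraMap, hs] at taylor
  obtain ⟨u, hu⟩ := ((Commute.all c n).isNilpotent_mul_left hn).isUnit_add_left_of_commute
    isUnit_derivative (.all _ _)
  exact ⟨u, by rw [taylor, hu]; ring⟩

open scoped IsMulCommutative in
lemma aeval_add_pow_eq_zero_iff [Ring A] [Algebra R A] (hg : g.Separable) {s n : A}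
    (hsn : Commute s n) (hs : aeval s g = 0) (hn : IsNilpotent n) (k : ℕ) :
    aeval (s + n) (g ^ k) = 0 ↔ n ^ k = 0 := by
  have : IsMulCommutative (Algebra.adjoin R {s, n}) := Algebra.isMulCommutative_adjoin R (by
    rintro x (rfl | rfl) y (rfl | rfl)
    exacts [rfl, hsn, hsn.symm, rfl])
  let s' : Algebra.adjoin R {s, n} := ⟨s, Algebra.subset_adjoin (Set.mem_insert s {n})⟩
  let n' : Algebra.adjoin R {s, n} := ⟨n, Algebra.subset_adjoin (Set.mem_insert_of_mem s rfl)⟩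
  have coe_aeval (x : Algebra.adjoin R {s, n}) (f : R[X]) : (aeval x f : A) = aeval (x : A) f :=
    (aeval_algHom_apply (Algebra.adjoin R {s, n}).val x f).symm
  have h : Associated n' (aeval (s' + n') g) := by
    refine associated_aeval_add_of_isNilpotent hg ?_ ?_
    · exact Subtype.ext ((coe_aeval s' g).trans hs)
    · obtain ⟨k, hk⟩ := hn
      exact ⟨k, Subtype.ext hk⟩
  have h' : n' ^ k = 0 ↔ aeval (s' + n') (g ^ k) = 0 := by
    rw [map_pow]
    exact h.pow_pow.eq_zero_iff
  simpa [Subtype.ext_iff, coe_aeval, s', n'] using h'.symm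

end Taylor

section Kronecker

variable {R m n : Type*} [CommRing R] [Fintype m] [DecidableEq m] [Fintype n] [DecidableEq n]

lemma aeval_one_kronecker (M : Matrix n n R) (f : R[X]) :
    aeval ((1 : Matrix m m R) ⊗ₖ M) f = (1 : Matrix m m R) ⊗ₖ aeval M f := by
  simpa using aeval_algHom_apply
    ((Matrix.kroneckerAlgEquiv m n R).toAlgHom.comp Algebra.TensorProduct.includeRight) M f

lemma kronecker_one_pow (M : Matrix m m R) (k : ℕ) :
    (M ⊗ₖ (1 : Matrix n n R)) ^ k = (M ^ k) ⊗ₖ (1 : Matrix n n R) := by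
  simpa using (map_pow ((Matrix.kroneckerAlgEquiv m n R).toAlgHom.comp
    (Algebra.TensorProduct.includeLeft (S := R))) M k).symm

lemma kronecker_one_eq_zero_iff {R m n : Type*} [MulZeroOneClass R] [DecidableEq n] [Nonempty n]
    {M : Matrix m m R} :
    M ⊗ₖ (1 : Matrix n n R) = 0 ↔ M = 0 := by
  refine ⟨fun h => ?_, fun h => by rw [h, Matrix.zero_kronecker]⟩
  obtain ⟨a⟩ := ‹Nonempty n›
  ext i j
  simpa using congrFun₂ h (i, a) (j, a)

end Kronecker

section Blocks

variable {K : Type*} [Field K]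

lemma charpoly_companion {g : K[X]} (hg : g.Monic) : (companion g).charpoly = g := by
  have companion_eq : companion g = (Algebra.leftMulMatrix (AdjoinRoot.powerBasis hg.ne_zero).basis
      (AdjoinRoot.powerBasis hg.ne_zero).gen)ᵀ := by
    rw [PowerBasis.leftMulMatrix, PowerBasis.minpolyGen_eq,
      AdjoinRoot.minpoly_powerBasis_gen_of_monic hg]
    ext i j
    simp only [companion, Matrix.of_apply, eq_comm]
    rfl
  calc (companion g).charpoly = _ := congrArg Matrix.charpoly companion_eq
    _ = minpoly K (AdjoinRoot.powerBasis hg.ne_zero).gen :=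
        (Matrix.charpoly_transpose _).trans (charpoly_leftMulMatrix _)
    _ = g := AdjoinRoot.minpoly_powerBasis_gen_of_monic hg

lemma shift_pow_apply (d m : ℕ) (i j : Fin d) :
    (shift K d ^ m) i j = if (i : ℕ) + m = j then 1 else 0 := by
  induction m generalizing i with
  | zero => simp [Matrix.one_apply, Fin.ext_iff]
  | succ m ih =>
    have shift_apply (l : Fin d) : shift K d i l = if (i : ℕ) + 1 = l then 1 else 0 := rfl
    simp only [pow_succ', Matrix.mul_apply, ih, shift_apply, ite_mul, one_mul, zero_mul]
    by_cases h : (i : ℕ) + 1 < d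
    · rw [Fintype.sum_eq_single ⟨i + 1, h⟩ fun l hl => if_neg fun hl' => hl (Fin.ext hl'.symm)]
      simp [add_assoc, add_comm 1 m]
    · rw [Finset.sum_eq_zero fun l _ => if_neg (by lia), if_neg (by lia)]

lemma shift_pow_eq_zero_iff (d m : ℕ) : shift K d ^ m = 0 ↔ d ≤ m := by
  refine ⟨fun h => ?_, fun h => ?_⟩
  · by_contra! hm
    simpa [shift_pow_apply] using congrFun₂ h ⟨0, by lia⟩ ⟨m, hm⟩
  · ext i j
    rw [shift_pow_apply, if_neg (by lia), Matrix.zero_apply]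

variable {g : K[X]} {d : ℕ}

lemma aeval_block_pow_eq_zero_iff (hg : g.Monic) (hg0 : g.natDegree ≠ 0) (hgs : g.Separable)
    (k : ℕ) : aeval (block g d) (g ^ k) = 0 ↔ d ≤ k := by
  let s := (1 : Matrix (Fin d) (Fin d) K) ⊗ₖ companion g
  let n := shift K d ⊗ₖ (1 : Matrix (Fin g.natDegree) (Fin g.natDegree) K)
  have : NeZero g.natDegree := ⟨hg0⟩
  have n_pow_eq_zero_iff (l : ℕ) : n ^ l = 0 ↔ d ≤ l := by
    rw [kronecker_one_pow, kronecker_one_eq_zero_iff, shift_pow_eq_zero_iff]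
  have aeval_s : aeval s g = 0 := by
    have h := Matrix.aeval_self_charpoly (companion g)
    rw [charpoly_companion hg] at h
    rw [aeval_one_kronecker, h, Matrix.kronecker_zero]
  have hsn : Commute s n := by simp [s, n, commute_iff_eq, ← Matrix.mul_kronecker_mul]
  calc aeval (block g d) (g ^ k) = 0
      ↔ Matrix.reindexAlgEquiv K K finProdFinEquiv (aeval (s + n) (g ^ k)) = 0 := by
        rw [← aeval_algHom_apply]; rfl
    _ ↔ aeval (s + n) (g ^ k) = 0 := map_eq_zero_iff _ (AlgEquiv.injective _)
    _ ↔ n ^ k = 0 :=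
        aeval_add_pow_eq_zero_iff hgs hsn aeval_s ⟨d, (n_pow_eq_zero_iff d).2 le_rfl⟩ k
    _ ↔ d ≤ k := n_pow_eq_zero_iff k

theorem minpoly_block (hg : g.Monic) (hgi : Irreducible g) (hgs : g.Separable) :
    minpoly K (block g d) = g ^ d := by
  have annihilates := aeval_block_pow_eq_zero_iff (d := d) hg hgi.natDegree_pos.ne' hgs
  obtain ⟨i, hi, h⟩ := (dvd_prime_pow hgi.prime d).1 (minpoly.dvd K _ ((annihilates d).2 le_rfl))
  have h := eq_of_monic_of_associated (minpoly.monic (Matrix.isIntegral _)) (hg.pow i) h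
  obtain rfl : i = d := hi.antisymm ((annihilates i).1 (h ▸ minpoly.aeval K _))
  exact h

theorem nonempty_xModule_block_equiv (hg : g.Monic) (hgi : Irreducible g) (hgs : g.Separable) :
    Nonempty (XModule (block g d) ≃ₗ[K[X]] K[X] ⧸ Ideal.span {g ^ d}) := by
  have minpoly_eq : minpoly K (Matrix.toLin' (block g d)) = g ^ d := by
    rw [Matrix.minpoly_toLin', minpoly_block hg hgi hgs]
  rw [← minpoly_eq]
  refine nonempty_aeval_equiv_quotient_minpoly ?_
  rw [minpoly_eq, natDegree_pow, Module.finrank_fintype_fun_eq_card, Fintype.card_fin]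

lemma charpoly_block (hg : g.Monic) : (block g d).charpoly = g ^ d := by
  have upper_triangular : ((1 : Matrix (Fin d) (Fin d) K) ⊗ₖ companion g +
      shift K d ⊗ₖ (1 : Matrix (Fin g.natDegree) (Fin g.natDegree) K)).BlockTriangular
        Prod.fst := by
    rintro ⟨i, a⟩ ⟨j, b⟩ (hij : j < i)
    have : (i : ℕ) + 1 ≠ j := by lia
    simp [shift, this, hij.ne']
  rw [block, Matrix.charpoly_reindex, charpoly_eq_prod_charpoly_toSquareBlock upper_triangular,
    Finset.prod_eq_pow_card fun i _ => ?_, Finset.card_univ, Fintype.card_fin]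
  let e : {x : Fin d × Fin g.natDegree // x.1 = i} ≃ Fin g.natDegree :=
    Equiv.prodSubtypeFstEquivSubtypeProd.trans (Equiv.uniqueProd _ {j : Fin d // j = i})
  rw [← Matrix.charpoly_reindex e]
  refine Eq.trans (congrArg Matrix.charpoly ?_) (charpoly_companion hg)
  ext a b
  have symm_apply (a : Fin g.natDegree) : e.symm a = ⟨(i, a), rfl⟩ := rfl
  simp [Matrix.toSquareBlock_def, shift, symm_apply]

end Blocks

section BlockSum

variable {K : Type*} [Field K] {n r : ℕ} {A : Matrix (Fin n) (Fin n) K} {g : Fin r → K[X]}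
  {d : Fin r → ℕ}

theorem isSimilarToBlockSum_iff : IsSimilarToBlockSum A g d ↔
    Nonempty (XModule A ≃ₗ[K[X]] Π j, XModule (block (g j) (d j))) := by
  have blockSum_equiv : XModule (blockSum g d) ≃ₗ[K[X]] Π j, XModule (block (g j) (d j)) :=
    XModule.reindex finSigmaFinEquiv _ ≪≫ₗ XModule.blockDiagonal' _
  constructor
  · rintro ⟨rfl, hT⟩
    obtain ⟨e⟩ := nonempty_xModule_equiv_iff.2 hT
    exact ⟨e ≪≫ₗ blockSum_equiv⟩
  · rintro ⟨e⟩
    let e' := e ≪≫ₗ blockSum_equiv.symm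
    obtain rfl : ∑ j, d j * (g j).natDegree = n := by
      simpa only [finrank_xModule, Fintype.card_fin] using (e'.restrictScalars K).finrank_eq.symm
    exact ⟨rfl, nonempty_xModule_equiv_iff.1 ⟨e'⟩⟩

theorem IsSimilarToBlockSum.charpoly_eq (hg : ∀ j, (g j).Monic) (h : IsSimilarToBlockSum A g d) :
    A.charpoly = ∏ j, g j ^ d j := by
  obtain ⟨rfl, T, rfl⟩ := h
  rw [Matrix.coe_units_inv, Matrix.charpoly_units_conj', Matrix.charpoly_reindex, blockSum,
    Matrix.charpoly_reindex, charpoly_blockDiagonal']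
  exact Finset.prod_congr rfl fun j _ => charpoly_block (hg j)

theorem IsPrimePowerFamily.isElementaryDivisors_iff [PerfectField K]
    (h : IsPrimePowerFamily g d) : IsElementaryDivisors A g d ↔ IsSimilarToBlockSum A g d := by
  have block_equiv (j : Fin r) :
      Nonempty (XModule (block (g j) (d j)) ≃ₗ[K[X]] K[X] ⧸ Submodule.span K[X] {g j ^ d j}) :=
    have ⟨monic, irreducible, _⟩ := h j
    nonempty_xModule_block_equiv monic irreducible
      (PerfectField.separable_of_irreducible irreducible)
  let e := LinearEquiv.piCongrRight (fun j => (block_equiv j).some) ≪≫ₗ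
    (DirectSum.linearEquivFunOnFintype K[X] (Fin r) _).symm
  rw [isSimilarToBlockSum_iff, IsElementaryDivisors, and_iff_right h]
  exact ⟨fun ⟨f⟩ => ⟨f ≪≫ₗ e.symm⟩, fun ⟨f⟩ => ⟨f ≪≫ₗ e⟩⟩

end BlockSum

section ElementaryDivisors

variable {K : Type*} [Field K] {n : ℕ}

theorem exists_isElementaryDivisors (A : Matrix (Fin n) (Fin n) K) :
    ∃ (r : ℕ) (g : Fin r → K[X]) (d : Fin r → ℕ), IsElementaryDivisors A g d := by
  classical
  obtain ⟨r, p, d, hp, hd, ⟨e⟩⟩ := exists_pi_quotient_equiv_of_isTorsion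
    (Module.AEval.isTorsion_of_finiteDimensional K (Fin n → K) (Matrix.toLin' A))
  have span_normalize (j : Fin r) : Ideal.span {p j ^ d j} = Ideal.span {normalize (p j) ^ d j} :=
    Ideal.span_singleton_eq_span_singleton.2 (normalize_associated (p j)).symm.pow_pow
  refine ⟨r, fun j => normalize (p j), d, fun j => ⟨monic_normalize (hp j).ne_zero,
    (normalize_associated _).symm.irreducible (hp j), Nat.pos_of_ne_zero (hd j)⟩, ⟨?_⟩⟩
  exact e ≪≫ₗ LinearEquiv.piCongrRight (fun j => Submodule.quotEquivOfEq _ _ (span_normalize j))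
    ≪≫ₗ (DirectSum.linearEquivFunOnFintype K[X] (Fin r) _).symm

theorem IsElementaryDivisors.exists_equiv {A : Matrix (Fin n) (Fin n) K} {r r' : ℕ}
    {g : Fin r → K[X]} {d : Fin r → ℕ} {g' : Fin r' → K[X]} {d' : Fin r' → ℕ}
    (h : IsElementaryDivisors A g d) (h' : IsElementaryDivisors A g' d') :
    ∃ σ : Fin r ≃ Fin r', ∀ j, g' (σ j) = g j ∧ d' (σ j) = d j := by
  obtain ⟨hg, ⟨e⟩⟩ := h
  obtain ⟨hg', ⟨e'⟩⟩ := h'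
  obtain ⟨σ, hσ⟩ := exists_equiv_of_pi_quotient_equiv (fun j => (hg j).2.1) (fun j => (hg' j).2.1)
    (fun j => (hg j).2.2.ne') (fun j => (hg' j).2.2.ne')
    ((DirectSum.linearEquivFunOnFintype K[X] (Fin r) _).symm ≪≫ₗ e.symm ≪≫ₗ e' ≪≫ₗ
      DirectSum.linearEquivFunOnFintype K[X] (Fin r') _)
  exact ⟨σ, fun j => ⟨eq_of_monic_of_associated (hg' _).1 (hg j).1 (hσ j).1, (hσ j).2⟩⟩

end ElementaryDivisors

end CompanionJordan

theorem mainTheorem2_general {K : Type*} [Field K] [PerfectField K] {n : ℕ}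
    (A : Matrix (Fin n) (Fin n) K) :
    (∃ (r : ℕ) (g : Fin r → K[X]) (d : Fin r → ℕ),
      CompanionJordan.IsElementaryDivisors A g d) ∧
    (∀ (r : ℕ) (g : Fin r → K[X]) (d : Fin r → ℕ),
      CompanionJordan.IsElementaryDivisors A g d →
        A.charpoly = ∏ j, g j ^ d j ∧ CompanionJordan.IsSimilarToBlockSum A g d) ∧
    (∀ (r r' : ℕ) (g : Fin r → K[X]) (d : Fin r → ℕ)
        (g' : Fin r' → K[X]) (d' : Fin r' → ℕ),
      CompanionJordan.IsPrimePowerFamily g d → CompanionJordan.IsPrimePowerFamily g' d' →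
      CompanionJordan.IsSimilarToBlockSum A g d → CompanionJordan.IsSimilarToBlockSum A g' d' →
        ∃ σ : Fin r ≃ Fin r', ∀ j, g' (σ j) = g j ∧ d' (σ j) = d j) := by
  refine ⟨CompanionJordan.exists_isElementaryDivisors A, fun r g d h => ?_,
    fun r r' g d g' d' hg hg' h h' => ?_⟩
  · have hA := h.1.isElementaryDivisors_iff.1 h
    exact ⟨hA.charpoly_eq fun j => (h.1 j).1, hA⟩
  · exact (hg.isElementaryDivisors_iff.2 h).exists_equiv (hg'.isElementaryDivisors_iff.2 h')

theorem mainTheorem2 (H : Subfield ℂ) (n : ℕ) (A : Matrix (Fin n) (Fin n) H) :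
    (∃ (r : ℕ) (g : Fin r → Polynomial H) (d : Fin r → ℕ),
      CompanionJordan.IsElementaryDivisors A g d) ∧
    (∀ (r : ℕ) (g : Fin r → Polynomial H) (d : Fin r → ℕ),
      CompanionJordan.IsElementaryDivisors A g d →
        A.charpoly = ∏ j, g j ^ d j ∧ CompanionJordan.IsSimilarToBlockSum A g d) ∧
    (∀ (r r' : ℕ) (g : Fin r → Polynomial H) (d : Fin r → ℕ)
        (g' : Fin r' → Polynomial H) (d' : Fin r' → ℕ),
      CompanionJordan.IsPrimePowerFamily g d → CompanionJordan.IsPrimePowerFamily g' d' →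
      CompanionJordan.IsSimilarToBlockSum A g d → CompanionJordan.IsSimilarToBlockSum A g' d' →
        ∃ σ : Fin r ≃ Fin r', ∀ j, g' (σ j) = g j ∧ d' (σ j) = d j) :=
  mainTheorem2_general A
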